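/- Fix $\alpha>0$. For $n\in\mathbb N=\{1,2,\dots\}$ let $(\mathbf X_t,\mathbf Y_t)_{t\ge 0}$ be the continuous-time random walk on $V=\{(x,y)\in\mathbb Z^2: y\ge x+1\}$ with generator $$(\mathbf B_nf)(u)=\sum_{v\in V}c_n(u,v)\,[f(v)-f(u)],$$ where $c_n(u,v)=0$ unless $u,v\in V$ are nearest neighbours in $\mathbb Z^2$ (that is, $\|u-v\|_1=1$), $c_n(u,v)=\alpha/n$ if $\{u,v\}$ is one of the slow edges $\{(0,y),(1,y)\}$ with $y\ge 2$ or $\{(x,0),(x,1)\}$ with $x\le -1$, and $c_n(u,v)=1$ for every other pair of nearest neighbours in $V$. Let $\mathbf E_{(x,y)}$ denote expectation for the walk started at $(x,y)\in V$, let $L_t(A)=\int_0^t\mathbf 1_{\{(\mathbf X_s,\mathbf Y_s)\in A\}}\,ds$ be the local time in $A\subseteq V$ until time $t$, and let $D=\{(x,y)\in\mathbb Z^2:y=x+1\}$. Then there exists a constant $c>0$ (which may depend on $\alpha$ but on nothing else) such that for all $(x,y)\in V$, all $n\in\mathbb N$ and all $t\ge 0$, $$\mathbf E_{(x,y)}\big[L_{tn^2}(D\setminus\{(0,1)\})\big]\le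 c\,n\sqrt t \qquad\text{and}\qquad \mathbf E_{(x,y)}\big[L_{tn^2}(\{(0,1)\})\big]\le c\,\log(1+tn^2),$$ and moreover $\mathbf E_{(x,y)}\big[L_{tn^2}(\{(0,1)\})\big]\le c\,\log(tn^2)$ whenever $tn^2\ge 2$. -/

import Mathlib

open MeasureTheory ProbabilityTheory Filter Topology
open scoped NNReal ENNReal

noncomputable section

namespace SlowBond

/-- The state space `V = {(x, y) ∈ ℤ × ℤ : y ≥ x + 1}`. -/
abbrev V : Type := {p : ℤ × ℤ // p.2 ≥ p.1 + 1}

/-- The `L¹`-distance on `V`. -/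
def l1dist (u v : V) : ℤ := |u.1.1 - v.1.1| + |u.1.2 - v.1.2|

/-- The set `U` of endpoints of slow edges:
`{x ∈ {0, 1}, y ≥ 2} ∪ {x ≤ -1, y ∈ {0, 1}}`. -/
def U : Set V :=
  {u | (u.1.1 = 0 ∨ u.1.1 = 1) ∧ 2 ≤ u.1.2} ∪ {u | u.1.1 ≤ -1 ∧ (u.1.2 = 0 ∨ u.1.2 = 1)}

/-- The set of (oriented) slow edges. -/
def slowEdges : Set (V × V) :=
  {e | e.1 ∈ U ∧ e.2 ∈ U ∧ l1dist e.1 e.2 = 1 ∧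
      |e.1.1.1 - e.2.1.1| = 1 ∧ 2 ≤ e.1.1.2 ∧ 2 ≤ e.2.1.2} ∪
  {e | e.1 ∈ U ∧ e.2 ∈ U ∧ l1dist e.1 e.2 = 1 ∧
      |e.1.1.2 - e.2.1.2| = 1 ∧ e.1.1.1 ≤ -1 ∧ e.2.1.1 ≤ -1}

open Classical in
/-- The jump rates: `α / n` across slow edges, `1` across every other nearest-neighbour edge of
`V`, and `0` between sites that are not nearest neighbours. -/
def rate (α : ℝ) (n : ℕ) (u v : V) : ℝ :=
  if l1dist u v = 1 then (if (u, v) ∈ slowEdges then α / n else 1) else 0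

/-- The generator `(B_n f)(u) = ∑_{v ∈ V} c_n(u, v) (f(v) - f(u))`. At most four terms of the sum
are non-zero. -/
def generator (α : ℝ) (n : ℕ) (f : V → ℝ) (u : V) : ℝ :=
  ∑' v : V, rate α n u v * (f v - f u)

/-- `Z` is, under `P`, the continuous-time random walk on `V` with generator `B_n` started at `z`:
a càdlàg `V`-valued process, adapted to the filtration `ℱ`, which starts at `z` and solves the
martingale problem for `B_n` on local (that is, finitely supported) functions. Since the jump rates
are bounded, this determines the law of the process. -/
structure IsWalk (α : ℝ) (n : ℕ) (z : V) {Ω : Type*} [mΩ : MeasurableSpace Ω]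
    (P : Measure Ω) (ℱ : Filtration ℝ≥0 mΩ) (Z : ℝ≥0 → Ω → V) : Prop where
  adapted : ∀ t, Measurable[ℱ t] (Z t)
  start : ∀ᵐ ω ∂P, Z 0 ω = z
  right_continuous : ∀ ω t, ContinuousWithinAt (fun s => Z s ω) (Set.Ici t) t
  left_limits : ∀ ω t, ∃ v, Tendsto (fun s => Z s ω) (𝓝[<] t) (𝓝 v)
  martingale : ∀ f : V → ℝ, f.support.Finite →
    Martingale
      (fun (t : ℝ≥0) ω =>
        f (Z t ω) - ∫ s in (0 : ℝ)..(t : ℝ), generator α n f (Z s.toNNReal ω)) ℱ P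

/-- The local time `L_t(A) = ∫₀ᵗ 1_{Z_s ∈ A} ds` of `Z` in `A` until time `t`. -/
def localTime {Ω : Type*} (Z : ℝ≥0 → Ω → V) (t : ℝ) (A : Set V) (ω : Ω) : ℝ≥0∞ :=
  ∫⁻ s in Set.Ioc (0 : ℝ) t, A.indicator (fun _ => 1) (Z s.toNNReal ω)

/-- The upper diagonal `D = {y = x + 1}`. -/
def D : Set V := {u | u.1.2 = u.1.1 + 1}

/-- The site `(0, 1)`. -/
def corner : V := ⟨(0, 1), by norm_num⟩

end SlowBond

end

/-! Test functions equal at both ends of every slow edge do not see the rate `α / n`: on them the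
generator is the Laplacian of `V` reflected at the diagonal. The bounds therefore hold uniformly in
`n` and `α`.

By Dynkin's formula, a bounded matched `F` with `F ≤ m` and `lap F ≥ κ 1_A - η` gives `E L_T(A) ≤ (m
- F(z) + η T) / κ`. It remains to choose `F` for each set.

Corner: `log quad` is subharmonic with a strictly positive Laplacian at the corner, as in
two-dimensional potential theory. Subtracting `quad / b` with `b` of order `quad z + T` bounds it
above at the cost `η = 4 / b`, and truncation from below makes it bounded; this gives `log (1 + T)`.

Rest of the diagonal: `expDiag` decays away from the diagonal at rate `l - 1`. Its Laplacian is of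
order `l - 1` on the diagonal part `x ≥ 1` and at least `-4 (l - 1) ^ 2` everywhere. Adding the
reflected function covers `x ≤ -1`, and `l - 1 = T ^ (-1/2)` balances the terms to give `√T`. -/

noncomputable section

namespace SlowBond

/-! ### The generator on matched functions -/

/-- The nearest-neighbour Laplacian of `V`, with reflection at the diagonal. -/
def lap (F : ℤ → ℤ → ℝ) (x y : ℤ) : ℝ :=
  (F (x - 1) y - F x y) + (F x (y + 1) - F x y) +
    if x + 2 ≤ y then (F (x + 1) y - F x y) + (F x (y - 1) - F x y) else 0

/-- `F` takes the same value at both ends of every slow edge. -/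
def Matched (F : ℤ → ℤ → ℝ) : Prop :=
  (∀ y, 2 ≤ y → F 0 y = F 1 y) ∧ ∀ x, x ≤ -1 → F x 0 = F x 1

theorem Matched.eq_of_mem_slowEdges {F : ℤ → ℤ → ℝ} (hF : Matched F) {u v : V}
    (h : (u, v) ∈ slowEdges) : F v.1.1 v.1.2 = F u.1.1 u.1.2 := by
  obtain ⟨⟨a, b⟩, hab⟩ := u
  obtain ⟨⟨c, d⟩, hcd⟩ := v
  simp only [slowEdges, U, l1dist, Set.mem_union, Set.mem_ofPred_eq] at h hab hcd ⊢
  rcases h with ⟨hu, hv, h1, h2, h3, h4⟩ | ⟨hu, hv, h1, h2, h3, h4⟩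
  · have hbd : b = d := by
      have := abs_nonneg (b - d)
      have : |b - d| = 0 := by omega
      have := abs_eq_zero.1 this
      omega
    subst hbd
    have ha : (a = 0 ∧ c = 1) ∨ (a = 1 ∧ c = 0) := by
      rcases abs_eq (by norm_num : (0 : ℤ) ≤ 1) |>.1 h2 with h | h <;> omega
    rcases ha with ⟨rfl, rfl⟩ | ⟨rfl, rfl⟩
    · exact (hF.1 _ h3).symm
    · exact hF.1 _ h3
  · have hac : a = c := by
      have : |a - c| = 0 := by omega
      have := abs_eq_zero.1 this
      omega
    subst hac
    have hb : (b = 0 ∧ d = 1) ∨ (b = 1 ∧ d = 0) := by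
      rcases abs_eq (by norm_num : (0 : ℤ) ≤ 1) |>.1 h2 with h | h <;> omega
    rcases hb with ⟨rfl, rfl⟩ | ⟨rfl, rfl⟩
    · exact (hF.2 _ h3).symm
    · exact hF.2 _ h3

theorem l1_eq_one_iff (x y a b : ℤ) :
    |x - a| + |y - b| = 1 ↔
      (a, b) ∈ ({(x - 1, y), (x, y + 1), (x + 1, y), (x, y - 1)} : Finset (ℤ × ℤ)) := by
  simp only [Finset.mem_insert, Finset.mem_singleton, Prod.mk.injEq]
  rcases abs_cases (x - a) with h | h <;> rcases abs_cases (y - b) with h' | h' <;> omega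

/-- Slow edges contribute zero differences, and every other edge has rate 1. -/
theorem generator_eq_lap (α : ℝ) (n : ℕ) {F : ℤ → ℤ → ℝ} (hF : Matched F) (u : V) :
    generator α n (fun v => F v.1.1 v.1.2) u = lap F u.1.1 u.1.2 := by
  classical
  have h1 : ∀ v : V, rate α n u v * (F v.1.1 v.1.2 - F u.1.1 u.1.2) =
      (fun p : ℤ × ℤ => if |u.1.1 - p.1| + |u.1.2 - p.2| = 1 then
        F p.1 p.2 - F u.1.1 u.1.2 else 0) v.1 := by
    intro v
    by_cases h : l1dist u v = 1
    · by_cases hs : (u, v) ∈ slowEdges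
      · simp [hF.eq_of_mem_slowEdges hs]
      · have h' : |u.1.1 - v.1.1| + |u.1.2 - v.1.2| = 1 := h
        simp [rate, h, hs, h']
    · have h' : ¬ |u.1.1 - v.1.1| + |u.1.2 - v.1.2| = 1 := h
      simp [rate, h, h']
  obtain ⟨⟨x, y⟩, hxy⟩ := u
  simp only [ge_iff_le] at hxy
  unfold generator
  rw [tsum_congr h1]
  -- Passing to an indicator on `ℤ × ℤ` lets the two neighbours that leave `V` at a diagonal site
  -- drop out.
  have h2 := tsum_subtype {p : ℤ × ℤ | p.2 ≥ p.1 + 1}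
    (fun p : ℤ × ℤ => if |x - p.1| + |y - p.2| = 1 then F p.1 p.2 - F x y else 0)
  refine h2.trans ?_
  rw [tsum_eq_sum (s := {(x - 1, y), (x, y + 1), (x + 1, y), (x, y - 1)})]
  · rw [Finset.sum_insert, Finset.sum_insert, Finset.sum_insert, Finset.sum_singleton]
    · have e1 : x ≤ y := by omega
      by_cases h : x + 2 ≤ y
      · have e2 : x + 1 < y := by omega
        have e3 : x < y - 1 := by omega
        simp [lap, Set.indicator, h, e1, e2, e3]
        ring
      · have e2 : ¬ x + 1 < y := by omega
        have e3 : ¬ x < y - 1 := by omega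
        simp [lap, Set.indicator, h, e1, e2, e3]
    all_goals simp
    all_goals omega
  · intro p hp
    rw [Set.indicator_apply_eq_zero]
    intro _
    rw [if_neg]
    rwa [l1_eq_one_iff]

/-! ### Path measurability and cutoffs -/

theorem measurable_path {Z : ℝ≥0 → V}
    (hZ : ∀ t, ContinuousWithinAt Z (Set.Ici t) t) (g : V → ℝ) :
    Measurable fun s : ℝ => g (Z s.toNNReal) := by
  have hg : Continuous g := continuous_of_discreteTopology
  suffices h : Measurable fun s : ℝ≥0 => g (Z s) from h.comp measurable_real_toNNReal
  -- Sampling at grid points strictly to the right of `s` makes right continuity sufficient.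
  refine measurable_of_tendsto_metrizable
    (f := fun (k : ℕ) (s : ℝ≥0) => g (Z ((⌊s * (k + 1)⌋₊ + 1 : ℕ) / (k + 1)))) (fun k => ?_) ?_
  · exact (measurable_from_top (f := fun m : ℕ => g (Z ((m + 1 : ℕ) / (k + 1))))).comp
      (Nat.measurable_floor.comp (measurable_id.mul_const _))
  · rw [tendsto_pi_nhds]
    intro s
    refine (hg.tendsto _).comp ((hZ s).tendsto.comp ?_)
    have hk : ∀ k : ℕ, (0 : ℝ≥0) < k + 1 := fun k => by positivity
    refine tendsto_nhdsWithin_iff.2 ⟨?_, Eventually.of_forall fun k => ?_⟩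
    · have hlim : Tendsto (fun k : ℕ => s + 1 / ((k : ℝ≥0) + 1)) atTop (𝓝 s) := by
        simpa using (tendsto_const_nhds (x := s)).add
          (tendsto_one_div_add_atTop_nhds_zero_nat (𝕜 := ℝ≥0))
      refine tendsto_of_tendsto_of_tendsto_of_le_of_le tendsto_const_nhds hlim ?_ ?_
      · intro k
        rw [le_div_iff₀ (hk k)]
        push_cast
        exact (Nat.lt_floor_add_one _).le
      · intro k
        simp only
        rw [div_le_iff₀ (hk k), add_mul, one_div_mul_cancel (hk k).ne']
        push_cast
        gcongr
        exact Nat.floor_le (by positivity)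
    · rw [Set.mem_Ici, le_div_iff₀ (hk k)]
      push_cast
      exact (Nat.lt_floor_add_one _).le

/-- `F` set to zero outside a box that contains both or neither of the ends of each slow edge. -/
def cutoff (F : ℤ → ℤ → ℝ) (k : ℕ) (x y : ℤ) : ℝ :=
  if |2 * x - 1| ≤ k ∧ |2 * y - 1| ≤ k then F x y else 0

theorem Matched.cutoff {F : ℤ → ℤ → ℝ} (hF : Matched F) (k : ℕ) : Matched (cutoff F k) := by
  refine ⟨fun y hy => ?_, fun x hx => ?_⟩
  · simp [SlowBond.cutoff, hF.1 y hy]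
  · simp [SlowBond.cutoff, hF.2 x hx]

theorem finite_support_cutoff (F : ℤ → ℤ → ℝ) (k : ℕ) :
    (Function.support fun v : V => cutoff F k v.1.1 v.1.2).Finite := by
  refine Set.Finite.subset (Set.Finite.preimage Subtype.val_injective.injOn
    ((Set.finite_Icc (-(k : ℤ)) (k + 1)).prod (Set.finite_Icc (-(k : ℤ)) (k + 1)))) ?_
  intro v hv
  have h : |2 * v.1.1 - 1| ≤ k ∧ |2 * v.1.2 - 1| ≤ k := by
    by_contra h
    exact hv (if_neg h)
  obtain ⟨h1, h2⟩ := h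
  rw [abs_le] at h1 h2
  simp only [Set.mem_preimage, Set.mem_prod, Set.mem_Icc]
  omega

theorem eventually_cutoff_eq (F : ℤ → ℤ → ℝ) (x y : ℤ) :
    ∀ᶠ k in atTop, cutoff F k x y = F x y := by
  filter_upwards [eventually_ge_atTop ((|2 * x - 1| + |2 * y - 1|).toNat)] with k hk
  refine if_pos ⟨?_, ?_⟩ <;>
  · have := abs_nonneg (2 * x - 1)
    have := abs_nonneg (2 * y - 1)
    omega

theorem abs_cutoff_le {F : ℤ → ℤ → ℝ} {R : ℝ} (k : ℕ) {x y : ℤ} (h : |F x y| ≤ R) :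
    |cutoff F k x y| ≤ R := by
  unfold cutoff
  split_ifs
  · exact h
  · simpa using (abs_nonneg _).trans h

theorem eventually_lap_cutoff_eq (F : ℤ → ℤ → ℝ) (x y : ℤ) :
    ∀ᶠ k in atTop, lap (cutoff F k) x y = lap F x y := by
  filter_upwards [eventually_cutoff_eq F x y, eventually_cutoff_eq F (x - 1) y,
    eventually_cutoff_eq F (x + 1) y, eventually_cutoff_eq F x (y - 1),
    eventually_cutoff_eq F x (y + 1)] with k h1 h2 h3 h4 h5
  simp only [lap, h1, h2, h3, h4, h5]

theorem abs_lap_le {F : ℤ → ℤ → ℝ} {R : ℝ} (hR : ∀ x y : ℤ, x + 1 ≤ y → |F x y| ≤ R)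
    {x y : ℤ} (hxy : x + 1 ≤ y) : |lap F x y| ≤ 8 * R := by
  have h0 := abs_le.1 (hR x y hxy)
  have h1 := abs_le.1 (hR (x - 1) y (by omega))
  have h2 := abs_le.1 (hR x (y + 1) (by omega))
  unfold lap
  rw [abs_le]
  split_ifs with h
  · have h3 := abs_le.1 (hR (x + 1) y (by omega))
    have h4 := abs_le.1 (hR x (y - 1) (by omega))
    constructor <;> linarith
  · constructor <;> linarith

/-! ### Dynkin's formula and the local time estimate -/

section Dynkin

variable {α : ℝ} {n : ℕ} {z : V} {Ω : Type*} {mΩ : MeasurableSpace Ω} {P : Measure Ω}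
  {ℱ : Filtration ℝ≥0 mΩ} {Z : ℝ≥0 → Ω → V}

theorem IsWalk.measurable (hZ : IsWalk α n z P ℱ Z) (g : V → ℝ) (t : ℝ≥0) :
    Measurable fun ω => g (Z t ω) :=
  (measurable_of_countable g).comp ((hZ.adapted t).mono (ℱ.le t) le_rfl)

variable [IsProbabilityMeasure P]

theorem IsWalk.integral_start (hZ : IsWalk α n z P ℱ Z) (g : V → ℝ) :
    ∫ ω, g (Z 0 ω) ∂P = g z := by
  have : (fun ω => g (Z 0 ω)) =ᵐ[P] fun _ => g z := by
    filter_upwards [hZ.start] with ω hω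
    rw [hω]
  rw [integral_congr_ae this]
  simp

/-- Dynkin's formula for bounded functions that are matched across slow edges. -/
theorem IsWalk.dynkin (hZ : IsWalk α n z P ℱ Z) {F : ℤ → ℤ → ℝ} (hF : Matched F) {R : ℝ}
    (hR : ∀ x y : ℤ, x + 1 ≤ y → |F x y| ≤ R) (T : ℝ≥0) :
    Integrable (fun ω => ∫ s in (0 : ℝ)..T,
      lap F (Z s.toNNReal ω).1.1 (Z s.toNNReal ω).1.2) P ∧
    ∫ ω, (∫ s in (0 : ℝ)..T, lap F (Z s.toNNReal ω).1.1 (Z s.toNNReal ω).1.2) ∂P =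
      ∫ ω, F (Z T ω).1.1 (Z T ω).1.2 ∂P - F z.1.1 z.1.2 := by
  have hk : ∀ k : ℕ, Integrable (fun ω => ∫ s in (0 : ℝ)..T,
      lap (cutoff F k) (Z s.toNNReal ω).1.1 (Z s.toNNReal ω).1.2) P ∧
      ∫ ω, (∫ s in (0 : ℝ)..T,
        lap (cutoff F k) (Z s.toNNReal ω).1.1 (Z s.toNNReal ω).1.2) ∂P =
      ∫ ω, cutoff F k (Z T ω).1.1 (Z T ω).1.2 ∂P - cutoff F k z.1.1 z.1.2 := by
    intro k
    have hm := hZ.martingale _ (finite_support_cutoff F k)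
    simp only [generator_eq_lap α n (hF.cutoff k)] at hm
    have hb : Integrable (fun ω => cutoff F k (Z T ω).1.1 (Z T ω).1.2) P := by
      refine Integrable.of_bound (hZ.measurable
        (fun v => cutoff F k v.1.1 v.1.2) T).aestronglyMeasurable R (Eventually.of_forall ?_)
      exact fun ω => abs_cutoff_le k (hR _ _ (Z T ω).2)
    have hi : Integrable (fun ω => ∫ s in (0 : ℝ)..T,
        lap (cutoff F k) (Z s.toNNReal ω).1.1 (Z s.toNNReal ω).1.2) P := by
      -- The time integral is a difference of integrable variables, so no joint measurability of the
      -- process is needed.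
      have := hb.sub (hm.integrable T)
      refine this.congr (Eventually.of_forall fun ω => ?_)
      simp
    refine ⟨hi, ?_⟩
    have h0 := hm.setIntegral_eq (zero_le (a := T)) MeasurableSet.univ
    simp only [setIntegral_univ, NNReal.coe_zero, intervalIntegral.integral_same, sub_zero] at h0
    rw [hZ.integral_start (fun v => cutoff F k v.1.1 v.1.2), integral_sub hb hi] at h0
    linarith
  -- The martingale problem covers finite support only; dominated convergence, with `8 * R` uniform
  -- in `k`, removes the cutoff.
  have hpt : ∀ ω, Tendsto (fun k : ℕ => ∫ s in (0 : ℝ)..T,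
      lap (cutoff F k) (Z s.toNNReal ω).1.1 (Z s.toNNReal ω).1.2) atTop
      (𝓝 (∫ s in (0 : ℝ)..T, lap F (Z s.toNNReal ω).1.1 (Z s.toNNReal ω).1.2)) := by
    intro ω
    refine intervalIntegral.tendsto_integral_filter_of_dominated_convergence (fun _ => 8 * R)
      (Eventually.of_forall fun k => ?_) (Eventually.of_forall fun k => ?_) (by simp) ?_
    · exact (measurable_path (hZ.right_continuous ω)
        (fun v => lap (cutoff F k) v.1.1 v.1.2)).aestronglyMeasurable
    · exact Eventually.of_forall fun s _ =>
        abs_lap_le (fun x y h => abs_cutoff_le k (hR x y h)) (Z s.toNNReal ω).2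
    · exact Eventually.of_forall fun s _ =>
        tendsto_nhds_of_eventually_eq (eventually_lap_cutoff_eq F _ _)
  have hbd : ∀ (k : ℕ) ω, ‖∫ s in (0 : ℝ)..T,
      lap (cutoff F k) (Z s.toNNReal ω).1.1 (Z s.toNNReal ω).1.2‖ ≤ 8 * R * |(T : ℝ) - 0| :=
    fun k ω => intervalIntegral.norm_integral_le_of_norm_le_const fun s _ =>
      abs_lap_le (fun x y h => abs_cutoff_le k (hR x y h)) (Z s.toNNReal ω).2
  have hmeas : AEStronglyMeasurable (fun ω => ∫ s in (0 : ℝ)..T,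
      lap F (Z s.toNNReal ω).1.1 (Z s.toNNReal ω).1.2) P :=
    aestronglyMeasurable_of_tendsto_ae atTop (fun k => (hk k).1.aestronglyMeasurable)
      (Eventually.of_forall hpt)
  refine ⟨Integrable.of_bound hmeas (8 * R * |(T : ℝ) - 0|) (Eventually.of_forall fun ω =>
    le_of_tendsto (hpt ω).norm (Eventually.of_forall fun k => hbd k ω)), ?_⟩
  have hl := tendsto_integral_of_dominated_convergence (μ := P)
    (fun _ => 8 * R * |(T : ℝ) - 0|) (fun k => (hk k).1.aestronglyMeasurable)
    (integrable_const _) (fun k => Eventually.of_forall (hbd k)) (Eventually.of_forall hpt)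
  have hr : Tendsto (fun k : ℕ => ∫ ω, cutoff F k (Z T ω).1.1 (Z T ω).1.2 ∂P) atTop
      (𝓝 (∫ ω, F (Z T ω).1.1 (Z T ω).1.2 ∂P)) := by
    refine tendsto_integral_of_dominated_convergence (fun _ => R) (fun k => (hZ.measurable
      (fun v => cutoff F k v.1.1 v.1.2) T).aestronglyMeasurable) (integrable_const _)
      (fun k => Eventually.of_forall fun ω => abs_cutoff_le k (hR _ _ (Z T ω).2))
      (Eventually.of_forall fun ω => tendsto_nhds_of_eventually_eq (eventually_cutoff_eq F _ _))
  refine tendsto_nhds_unique hl ?_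
  simp only [fun k => (hk k).2]
  exact hr.sub (tendsto_nhds_of_eventually_eq (eventually_cutoff_eq F _ _))

theorem intervalIntegrable_path {w : ℝ≥0 → V} (hw : ∀ t, ContinuousWithinAt w (Set.Ici t) t)
    {g : V → ℝ} {R : ℝ} (hg : ∀ v, |g v| ≤ R) (a b : ℝ) :
    IntervalIntegrable (fun s : ℝ => g (w s.toNNReal)) volume a b :=
  (intervalIntegrable_const (c := R)).mono_fun (measurable_path hw g).aestronglyMeasurable
    (Eventually.of_forall fun _ => (hg _).trans (le_abs_self R))

theorem abs_indicator_one_le (A : Set V) (v : V) : |A.indicator (fun _ => (1 : ℝ)) v| ≤ 1 := by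
  by_cases h : v ∈ A <;> simp [h]

theorem localTime_eq_ofReal {w : ℝ≥0 → V} (hw : ∀ t, ContinuousWithinAt w (Set.Ici t) t)
    {T : ℝ} (hT : 0 ≤ T) (A : Set V) :
    ∫⁻ s in Set.Ioc (0 : ℝ) T, A.indicator (fun _ => (1 : ℝ≥0∞)) (w s.toNNReal) =
      ENNReal.ofReal (∫ s in (0 : ℝ)..T, A.indicator (fun _ => (1 : ℝ)) (w s.toNNReal)) := by
  rw [intervalIntegral.integral_of_le hT, ofReal_integral_eq_lintegral_ofReal]
  · refine lintegral_congr fun s => ?_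
    by_cases h : w s.toNNReal ∈ A <;> simp [h]
  · exact (intervalIntegrable_path hw (abs_indicator_one_le A) 0 T).1
  · refine Eventually.of_forall fun s => ?_
    by_cases h : w s.toNNReal ∈ A <;> simp [h]

/-- A bounded function with `lap F ≥ κ 1_A - η` and `F ≤ m` bounds the expected local time in
`A`. -/
theorem IsWalk.lintegral_localTime_le (hZ : IsWalk α n z P ℱ Z) {F : ℤ → ℤ → ℝ}
    (hF : Matched F) {R : ℝ} (hR : ∀ x y : ℤ, x + 1 ≤ y → |F x y| ≤ R) {m : ℝ}
    (hm : ∀ x y : ℤ, x + 1 ≤ y → F x y ≤ m) {A : Set V} {κ η : ℝ} (hκ : 0 < κ)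
    (hlap : ∀ u : V, κ * A.indicator (fun _ => (1 : ℝ)) u - η ≤ lap F u.1.1 u.1.2)
    {T : ℝ} (hT : 0 ≤ T) :
    ∫⁻ ω, localTime Z T A ω ∂P ≤ ENNReal.ofReal ((m - F z.1.1 z.1.2 + η * T) / κ) := by
  lift T to ℝ≥0 using hT
  obtain ⟨hi, he⟩ := hZ.dynkin hF hR T
  have hle : ∀ ω, ∫ s in (0 : ℝ)..T, A.indicator (fun _ => (1 : ℝ)) (Z s.toNNReal ω) ≤
      ((∫ s in (0 : ℝ)..T, lap F (Z s.toNNReal ω).1.1 (Z s.toNNReal ω).1.2) + η * T) / κ := by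
    intro ω
    have hint : IntervalIntegrable (fun s : ℝ => lap F (Z s.toNNReal ω).1.1 (Z s.toNNReal ω).1.2)
        volume 0 T :=
      intervalIntegrable_path (hZ.right_continuous ω) (g := fun v => lap F v.1.1 v.1.2)
        (fun v => abs_lap_le hR v.2) 0 T
    have hind : IntervalIntegrable (fun s : ℝ => A.indicator (fun _ => (1 : ℝ)) (Z s.toNNReal ω))
        volume 0 T :=
      intervalIntegrable_path (hZ.right_continuous ω) (abs_indicator_one_le A) 0 T
    have := intervalIntegral.integral_mono_on T.coe_nonneg ((hind.const_mul κ).sub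
      (intervalIntegrable_const (c := η))) hint (fun s _ => hlap (Z s.toNNReal ω))
    rw [intervalIntegral.integral_sub (hind.const_mul κ) (intervalIntegrable_const (c := η)),
      intervalIntegral.integral_const_mul, intervalIntegral.integral_const] at this
    rw [le_div_iff₀ hκ]
    simp only [sub_zero, smul_eq_mul] at this
    linarith
  have h0 : ∀ ω, 0 ≤ ∫ s in (0 : ℝ)..T, A.indicator (fun _ => (1 : ℝ)) (Z s.toNNReal ω) :=
    fun ω => intervalIntegral.integral_nonneg T.coe_nonneg fun s _ =>
      Set.indicator_nonneg (fun _ _ => zero_le_one) _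
  calc ∫⁻ ω, localTime Z T A ω ∂P
      ≤ ∫⁻ ω, ENNReal.ofReal (((∫ s in (0 : ℝ)..T,
          lap F (Z s.toNNReal ω).1.1 (Z s.toNNReal ω).1.2) + η * T) / κ) ∂P := by
        refine lintegral_mono fun ω => ?_
        rw [localTime, localTime_eq_ofReal (hZ.right_continuous ω) T.coe_nonneg]
        exact ENNReal.ofReal_le_ofReal (hle ω)
    _ = ENNReal.ofReal (∫ ω, ((∫ s in (0 : ℝ)..T,
          lap F (Z s.toNNReal ω).1.1 (Z s.toNNReal ω).1.2) + η * T) / κ ∂P) := by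
        refine (ofReal_integral_eq_lintegral_ofReal ((hi.add (integrable_const _)).div_const κ)
          (Eventually.of_forall fun ω => (h0 ω).trans (hle ω))).symm
    _ ≤ _ := by
        refine ENNReal.ofReal_le_ofReal ?_
        rw [integral_div, integral_add hi (integrable_const _), he]
        have hF : Integrable (fun ω => F (Z T ω).1.1 (Z T ω).1.2) P :=
          Integrable.of_bound (hZ.measurable (fun v => F v.1.1 v.1.2) T).aestronglyMeasurable
            R (Eventually.of_forall fun ω => hR _ _ (Z T ω).2)
        have : ∫ ω, F (Z T ω).1.1 (Z T ω).1.2 ∂P ≤ m := by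
          simpa using integral_mono hF (integrable_const m) fun ω => hm _ _ (Z T ω).2
        simp only [integral_const, probReal_univ, one_smul]
        gcongr

end Dynkin
-- Reflection and truncation of test functions
theorem lap_add (F G : ℤ → ℤ → ℝ) (x y : ℤ) :
    lap (fun a b => F a b + G a b) x y = lap F x y + lap G x y := by
  unfold lap
  split_ifs <;> ring

/-- The reflection of `V` that exchanges the two families of slow edges. -/
def reflect (F : ℤ → ℤ → ℝ) (x y : ℤ) : ℝ := F (1 - y) (1 - x)

theorem lap_reflect (F : ℤ → ℤ → ℝ) (x y : ℤ) : lap (reflect F) x y = lap F (1 - y) (1 - x) := by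
  have e : (1 - y + 2 ≤ 1 - x) = (x + 2 ≤ y) := by
    rw [eq_iff_iff]; omega
  unfold lap reflect
  simp only [e, show 1 - (x - 1) = 1 - x + 1 by ring, show 1 - (y + 1) = 1 - y - 1 by ring,
    show 1 - (x + 1) = 1 - x - 1 by ring, show 1 - (y - 1) = 1 - y + 1 by ring]
  split_ifs <;> ring

theorem Matched.reflect {F : ℤ → ℤ → ℝ} (hF : Matched F) : Matched (reflect F) := by
  refine ⟨fun y hy => ?_, fun x hx => ?_⟩
  · simpa [SlowBond.reflect] using (hF.2 (1 - y) (by omega)).symm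
  · simpa [SlowBond.reflect] using (hF.1 (1 - x) (by omega)).symm

theorem Matched.add {F G : ℤ → ℤ → ℝ} (hF : Matched F) (hG : Matched G) :
    Matched fun a b => F a b + G a b :=
  ⟨fun y hy => by simp only [hF.1 y hy, hG.1 y hy],
    fun x hx => by simp only [hF.2 x hx, hG.2 x hx]⟩

/-- Truncation from below leaves the value at the site unchanged and can only raise the neighbours.
-/
theorem lap_max_le (F : ℤ → ℤ → ℝ) (K : ℝ) {x y : ℤ} (h : K ≤ F x y) :
    lap F x y ≤ lap (fun a b => max (F a b) K) x y := by
  have h1 := le_max_left (F (x - 1) y) K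
  have h2 := le_max_left (F x (y + 1)) K
  have h3 := le_max_left (F (x + 1) y) K
  have h4 := le_max_left (F x (y - 1)) K
  unfold lap
  simp only [max_eq_left h]
  split_ifs <;> linarith

theorem lap_max_nonneg (F : ℤ → ℤ → ℝ) (K : ℝ) {x y : ℤ} (h : F x y ≤ K) :
    0 ≤ lap (fun a b => max (F a b) K) x y := by
  have h1 := le_max_right (F (x - 1) y) K
  have h2 := le_max_right (F x (y + 1)) K
  have h3 := le_max_right (F (x + 1) y) K
  have h4 := le_max_right (F x (y - 1)) K
  unfold lap
  simp only [max_eq_right h]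
  split_ifs <;> linarith

/-! ### The logarithmic test function -/

/-- The squared distance to `(1/2, 1/2)`, shifted to equal `4` at the corner; it satisfies
`lap quad = 4`. -/
def quad (x y : ℤ) : ℝ := 4 + x * (x - 1) + y * (y - 1)

theorem matched_quad : Matched quad := by
  constructor <;> intros <;> simp [quad]

theorem int_mul_sub_one_nonneg (x : ℤ) : (0 : ℝ) ≤ x * (x - 1) := by
  have : 0 ≤ x * (x - 1) := by
    rcases le_or_gt x 0 with h | h <;> nlinarith
  exact_mod_cast this

theorem four_le_quad (x y : ℤ) : 4 ≤ quad x y := by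
  have := int_mul_sub_one_nonneg x
  have := int_mul_sub_one_nonneg y
  unfold quad
  linarith

theorem lap_quad {x y : ℤ} (hxy : x + 1 ≤ y) : lap quad x y = 4 := by
  unfold lap quad
  split_ifs with h
  · push_cast; ring
  · obtain rfl : y = x + 1 := by omega
    push_cast; ring

/-- The logarithm of `quad` is subharmonic. -/
theorem lap_log_quad_nonneg {x y : ℤ} (hxy : x + 1 ≤ y) :
    0 ≤ lap (fun a b => Real.log (quad a b)) x y := by
  have pos : ∀ a b, 0 < quad a b := fun a b => by linarith [four_le_quad a b]
  have hp := int_mul_sub_one_nonneg x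
  have hr := int_mul_sub_one_nonneg y
  have h1 := pos (x - 1) y
  have h2 := pos x (y + 1)
  have h3 := pos (x + 1) y
  have h4 := pos x (y - 1)
  have h0 := pos x y
  unfold lap
  split_ifs with h
  · have key : quad x y ^ 4 ≤
        quad (x - 1) y * quad x (y + 1) * (quad (x + 1) y * quad x (y - 1)) := by
      have e1 : quad (x - 1) y * quad (x + 1) y =
          quad x y ^ 2 + 2 * quad x y - 4 * (x * (x - 1)) := by
        unfold quad; push_cast; ring
      have e2 : quad x (y + 1) * quad x (y - 1) =
          quad x y ^ 2 + 2 * quad x y - 4 * (y * (y - 1)) := by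
        unfold quad; push_cast; ring
      have e3 : quad x y = 4 + x * (x - 1) + y * (y - 1) := rfl
      calc quad x y ^ 4 ≤ (quad x y ^ 2 + 2 * quad x y - 4 * (x * (x - 1))) *
            (quad x y ^ 2 + 2 * quad x y - 4 * (y * (y - 1))) := by
            generalize (x : ℝ) * (x - 1) = p at *
            generalize (y : ℝ) * (y - 1) = r at *
            generalize quad x y = s at *
            have : (s ^ 2 + 2 * s - 4 * p) * (s ^ 2 + 2 * s - 4 * r) - s ^ 4 =
              12 * s ^ 2 + 32 * s + 16 * (p * r) := by
              rw [e3]; ring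
            have := mul_nonneg hp hr
            nlinarith
        _ = _ := by rw [← e1, ← e2]; ring
    have := Real.log_le_log (by positivity) key
    rw [Real.log_pow, Real.log_mul (by positivity) (by positivity),
      Real.log_mul (by positivity) (by positivity),
      Real.log_mul (by positivity) (by positivity)] at this
    push_cast at this
    linarith
  · obtain rfl : y = x + 1 := by omega
    have key : quad x (x + 1) ^ 2 ≤ quad (x - 1) (x + 1) * quad x (x + 1 + 1) := by
      have : quad (x - 1) (x + 1) * quad x (x + 1 + 1) - quad x (x + 1) ^ 2 =
          20 + 4 * (x : ℝ) ^ 2 := by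
        unfold quad; push_cast; ring
      nlinarith [sq_nonneg (x : ℝ)]
    have := Real.log_le_log (by positivity) key
    rw [Real.log_pow, Real.log_mul (by positivity) (by positivity)] at this
    push_cast at this
    linarith

theorem lap_log_quad_corner :
    lap (fun a b => Real.log (quad a b)) 0 1 = 2 * Real.log (3 / 2) := by
  have h : Real.log (3 / 2) = Real.log 6 - Real.log 4 := by
    rw [← Real.log_div (by norm_num) (by norm_num)]; norm_num
  rw [h]
  norm_num [lap, quad]
  ring

/-! ### The exponential test function -/

/-- Exponential test function for the part of the diagonal in `x ≥ 1`, reflected at the slow edges. -/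
def expDiag (l : ℝ) (x y : ℤ) : ℝ :=
  -(l ^ (-max y 1) * (l ^ max x 0 + l ^ (1 - max x 0)))

theorem matched_expDiag (l : ℝ) : Matched (expDiag l) := by
  refine ⟨fun y _ => ?_, fun x _ => ?_⟩
  · simp [expDiag, add_comm]
  · simp [expDiag]

theorem expDiag_nonpos {l : ℝ} (hl : 1 < l) (x y : ℤ) : expDiag l x y ≤ 0 := by
  have : 0 < l := by linarith
  unfold expDiag
  rw [neg_nonpos]
  positivity

theorem neg_two_le_expDiag {l : ℝ} (hl : 1 < l) {x y : ℤ} (hxy : x + 1 ≤ y) :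
    -2 ≤ expDiag l x y := by
  have h0 : l ≠ 0 := by linarith
  unfold expDiag
  rw [mul_add, ← zpow_add₀ h0, ← zpow_add₀ h0]
  have h1 : l ^ (-max y 1 + max x 0) ≤ 1 := zpow_le_one_of_nonpos₀ hl.le (by omega)
  have h2 : l ^ (-max y 1 + (1 - max x 0)) ≤ 1 := zpow_le_one_of_nonpos₀ hl.le (by omega)
  linarith

/-- Here the factor in `x` is constantly `1 + l`, also at `x + 1`, so only the second difference in
`y` remains. -/
theorem lap_expDiag_of_nonpos {l : ℝ} (hl : 1 < l) {x y : ℤ} (hxy : x + 1 ≤ y) (hx : x ≤ 0) :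
    -(4 * (l - 1) ^ 2) ≤ lap (expDiag l) x y := by
  have h0 : l ≠ 0 := by linarith
  have m0 : max x 0 = 0 := by omega
  have m1 : max (x - 1) 0 = 0 := by omega
  have hl2 := sq_nonneg (l - 1)
  have hE : l ^ max (x + 1) 0 + l ^ (1 - max (x + 1) 0) = 1 + l := by
    rcases eq_or_lt_of_le hx with rfl | h
    · simp [add_comm]
    · have : max (x + 1) 0 = 0 := by omega
      simp [this]
  have hE0 : l ^ max x 0 + l ^ (1 - max x 0) = 1 + l := by simp [m0]
  have hE1 : l ^ max (x - 1) 0 + l ^ (1 - max (x - 1) 0) = 1 + l := by simp [m1]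
  unfold lap expDiag
  simp only [hE, hE0, hE1]
  rcases le_or_gt y 1 with hy | hy
  · have n0 : max y 1 = 1 := by omega
    have n1 : max (y - 1) 1 = 1 := by omega
    have hle : l ^ (-max (y + 1) 1) ≤ l ^ (-1 : ℤ) := zpow_le_zpow_right₀ hl.le (by omega)
    simp only [n0, n1]
    have := mul_le_mul_of_nonneg_right hle (by linarith : 0 ≤ 1 + l)
    split_ifs <;> linarith
  · have n0 : max y 1 = y := by omega
    have n1 : max (y - 1) 1 = y - 1 := by omega
    have n2 : max (y + 1) 1 = y + 1 := by omega
    rw [if_pos (by omega), n0, n1, n2, show -y = -(y + 1) + 1 by ring,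
      show -(y - 1) = -(y + 1) + 1 + 1 by ring, zpow_add_one₀ h0, zpow_add_one₀ h0,
      zpow_add_one₀ h0]
    have hle : l ^ (-(y + 1)) * (1 + l) ≤ 2 := by
      have h1 : l ^ (-(y + 1)) ≤ 1 := zpow_le_one_of_nonpos₀ hl.le (by omega)
      have h2 : l ^ (-(y + 1)) * l ≤ 1 := by
        rw [← zpow_add_one₀ h0]; exact zpow_le_one_of_nonpos₀ hl.le (by omega)
      linarith
    have := mul_le_mul_of_nonneg_right hle hl2
    nlinarith

/-- Off the diagonal with `x ≥ 1` the function is an eigenfunction of `lap` with eigenvalue `2 * (l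
+ l⁻¹ - 2)`, of order `(l - 1) ^ 2`. -/
theorem lap_expDiag_of_pos {l : ℝ} (hl : 1 < l) {x y : ℤ} (hxy : x + 2 ≤ y) (hx : 1 ≤ x) :
    -(4 * (l - 1) ^ 2) ≤ lap (expDiag l) x y := by
  have h0 : l ≠ 0 := by linarith
  have hp : 0 < l := by linarith
  have hlo := neg_two_le_expDiag hl (show x + 1 ≤ y by omega)
  have hE : lap (expDiag l) x y = 2 * (l + l⁻¹ - 2) * expDiag l x y := by
    have n0 : max y 1 = y := by omega
    have n1 : max (y - 1) 1 = y - 1 := by omega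
    have n2 : max (y + 1) 1 = y + 1 := by omega
    have m0 : max x 0 = x := by omega
    have m1 : max (x - 1) 0 = x - 1 := by omega
    have m2 : max (x + 1) 0 = x + 1 := by omega
    unfold lap expDiag
    rw [if_pos hxy, n0, n1, n2, m0, m1, m2]
    simp only [neg_add, neg_sub, zpow_add₀ h0, zpow_sub₀ h0, zpow_neg, zpow_one]
    field_simp
    ring
  have hk : 0 ≤ l + l⁻¹ - 2 ∧ l + l⁻¹ - 2 ≤ (l - 1) ^ 2 := by
    have e : l + l⁻¹ - 2 = (l - 1) ^ 2 * l⁻¹ := by field_simp; ring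
    rw [e]
    have : l⁻¹ ≤ 1 := inv_le_one_of_one_le₀ hl.le
    exact ⟨by positivity, mul_le_of_le_one_right (sq_nonneg _) this⟩
  rw [hE]
  nlinarith

/-- Only the two outward jumps remain on the diagonal, so the Laplacian is a first-order difference,
of order `l - 1` rather than `(l - 1) ^ 2`. -/
theorem lap_expDiag_diag {l : ℝ} (hl : 1 < l) (hl2 : l ≤ 2) {x : ℤ} (hx : 1 ≤ x) :
    (l - 1) / 4 ≤ lap (expDiag l) x (x + 1) := by
  have h0 : l ≠ 0 := by linarith
  have hp : 0 < l := by linarith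
  have hE : lap (expDiag l) x (x + 1) =
      (l - 1) * (l ^ 2)⁻¹ * (1 + (1 - l ^ (1 - x) * l ^ (1 - x)) + l ^ (1 - x) * l ^ (1 - x) * l⁻¹) := by
    have n0 : max (x + 1) 1 = x + 1 := by omega
    have n2 : max (x + 1 + 1) 1 = x + 1 + 1 := by omega
    have m0 : max x 0 = x := by omega
    have m1 : max (x - 1) 0 = x - 1 := by omega
    unfold lap expDiag
    rw [if_neg (by omega), n0, n2, m0, m1]
    simp only [neg_add, zpow_add₀ h0, zpow_sub₀ h0, zpow_neg, zpow_one]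
    field_simp
    ring
  have h1 : l ^ (1 - x) ≤ 1 := zpow_le_one_of_nonpos₀ hl.le (by omega)
  have h2 : 0 < l ^ (1 - x) := by positivity
  have h3 : l ^ (1 - x) * l ^ (1 - x) ≤ 1 := mul_le_one₀ h1 h2.le h1
  have h4 : (1 / 4 : ℝ) ≤ (l ^ 2)⁻¹ := by
    rw [one_div]
    exact inv_anti₀ (by positivity) (by nlinarith)
  rw [hE, div_eq_mul_one_div, mul_assoc]
  refine mul_le_mul_of_nonneg_left ?_ (by linarith)
  have h5 : 0 < l ^ (1 - x) * l ^ (1 - x) * l⁻¹ := by positivity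
  nlinarith

theorem le_lap_expDiag {l : ℝ} (hl : 1 < l) (hl2 : l ≤ 2) {x y : ℤ} (hxy : x + 1 ≤ y) :
    -(4 * (l - 1) ^ 2) ≤ lap (expDiag l) x y := by
  rcases le_or_gt x 0 with hx | hx
  · exact lap_expDiag_of_nonpos hl hxy hx
  · rcases eq_or_lt_of_le hxy with rfl | h
    · have := lap_expDiag_diag hl hl2 (x := x) (by omega)
      nlinarith [sq_nonneg (l - 1)]
    · exact lap_expDiag_of_pos hl (by omega) (by omega)

/-! ### Local time bounds for the walk -/

section Walk

variable {α : ℝ} {n : ℕ} {z : V} {Ω : Type*} {mΩ : MeasurableSpace Ω} {P : Measure Ω}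
  [IsProbabilityMeasure P] {ℱ : Filtration ℝ≥0 mΩ} {Z : ℝ≥0 → Ω → V}

theorem IsWalk.lintegral_localTime_corner_le (hZ : IsWalk α n z P ℱ Z) {T : ℝ} (hT : 0 ≤ T) :
    ∫⁻ ω, localTime Z T {corner} ω ∂P ≤
      ENNReal.ofReal (1 / (2 * Real.log (3 / 2)) * Real.log (1 + T)) := by
  have hκ : 0 < 2 * Real.log (3 / 2) := mul_pos two_pos (Real.log_pos (by norm_num))
  have hq := four_le_quad z.1.1 z.1.2
  obtain ⟨b, hb⟩ : ∃ b, b = quad z.1.1 z.1.2 + 4 * T := ⟨_, rfl⟩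
  have hb0 : 0 < b := by linarith
  let G : ℤ → ℤ → ℝ := fun x y => Real.log (quad x y) + -(quad x y / b)
  -- Truncating at this level makes the function bounded without changing it at the start or the
  -- corner.
  obtain ⟨K, hKz, hKc⟩ : ∃ K, K ≤ G z.1.1 z.1.2 ∧ K ≤ G 0 1 :=
    ⟨min (G z.1.1 z.1.2) (G 0 1), min_le_left _ _, min_le_right _ _⟩
  have hG : ∀ x y, G x y ≤ Real.log b - 1 := by
    intro x y
    have hpos : 0 < quad x y := by linarith [four_le_quad x y]
    have := Real.log_le_sub_one_of_pos (div_pos hpos hb0)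
    rw [Real.log_div hpos.ne' hb0.ne'] at this
    simp only [G]
    linarith
  have hKm : K ≤ Real.log b - 1 := hKz.trans (hG _ _)
  have hlapG : ∀ x y : ℤ, x + 1 ≤ y →
      lap G x y = lap (fun a b => Real.log (quad a b)) x y - 4 / b := by
    intro x y hxy
    have e : lap (fun a c => -(quad a c / b)) x y = -(lap quad x y / b) := by
      unfold lap
      split_ifs <;> ring
    rw [lap_add, e, lap_quad hxy]
    ring
  have hmatch : Matched fun x y => max (G x y) K :=
    ⟨fun y hy => by simp only [G, matched_quad.1 y hy],
      fun x hx => by simp only [G, matched_quad.2 x hx]⟩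
  have main := hZ.lintegral_localTime_le hmatch (R := max |K| |Real.log b - 1|)
    (m := Real.log b - 1) (A := {corner}) (η := 4 / b)
    (fun x y _ => abs_le_max_abs_abs (le_max_right _ _) (max_le (hG x y) hKm))
    (fun x y _ => max_le (hG x y) hKm) hκ ?_ hT
  · refine main.trans (ENNReal.ofReal_le_ofReal ?_)
    rw [max_eq_left hKz, div_eq_inv_mul, one_div]
    refine mul_le_mul_of_nonneg_left ?_ (inv_nonneg.2 hκ.le)
    have hpos : 0 < quad z.1.1 z.1.2 := by linarith
    -- The choice of `b` makes `quad z / b + 4 * T / b = 1`, which cancels the `-1`; then `quad z ≥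
    -- 4` gives `b / quad z ≤ 1 + T`.
    have e : Real.log b - 1 - G z.1.1 z.1.2 + 4 / b * T = Real.log (b / quad z.1.1 z.1.2) := by
      rw [Real.log_div hb0.ne' hpos.ne']
      have : quad z.1.1 z.1.2 / b + 4 / b * T = 1 := by
        rw [hb] at hb0 ⊢
        field_simp
      simp only [G]
      linarith
    rw [e]
    refine Real.log_le_log (by positivity) ?_
    rw [div_le_iff₀ hpos, hb]
    nlinarith
  · intro u
    have hu := u.2
    have h4b : 0 < 4 / b := by positivity
    by_cases hc : u = corner
    · subst hc
      have h1 := lap_max_le G K hKc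
      rw [hlapG 0 1 (by norm_num), lap_log_quad_corner] at h1
      simpa [corner] using h1
    · rw [Set.indicator_of_notMem (by simpa using hc), mul_zero, zero_sub]
      rcases le_total K (G u.1.1 u.1.2) with h | h
      · have h1 := lap_max_le G K h
        rw [hlapG _ _ hu] at h1
        have := lap_log_quad_nonneg hu
        linarith
      · have := lap_max_nonneg G K h
        linarith

theorem lintegral_localTime_le_ofReal (A : Set V) (T : ℝ) :
    ∫⁻ ω, localTime Z T A ω ∂P ≤ ENNReal.ofReal T := by
  have : ∀ ω, localTime Z T A ω ≤ ENNReal.ofReal T := by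
    intro ω
    calc localTime Z T A ω ≤ ∫⁻ _ in Set.Ioc (0 : ℝ) T, 1 :=
          lintegral_mono fun s => Set.indicator_le_self' (fun _ _ => zero_le) _
      _ = _ := by simp
  simpa using lintegral_mono (μ := P) this

theorem IsWalk.lintegral_localTime_diag_le (hZ : IsWalk α n z P ℱ Z) {T : ℝ} (hT : 0 ≤ T) :
    ∫⁻ ω, localTime Z T (D \ {corner}) ω ∂P ≤ ENNReal.ofReal (48 * Real.sqrt T) := by
  rcases le_or_gt T 1 with h1 | h1
  · refine (lintegral_localTime_le_ofReal _ T).trans (ENNReal.ofReal_le_ofReal ?_)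
    have h2 := Real.sqrt_nonneg T
    have h3 : Real.sqrt T ≤ 1 := Real.sqrt_le_one.2 h1
    nlinarith [Real.sq_sqrt hT]
  obtain ⟨r, hr⟩ : ∃ r, r = (Real.sqrt T)⁻¹ := ⟨_, rfl⟩
  have hs : 1 < Real.sqrt T := Real.lt_sqrt_of_sq_lt (by linarith)
  have hr0 : 0 < r := by rw [hr]; positivity
  have hr1 : r ≤ 1 := by rw [hr]; exact inv_le_one_of_one_le₀ hs.le
  have hl : 1 < 1 + r := by linarith
  have hl2 : 1 + r ≤ 2 := by linarith
  have hm := matched_expDiag (1 + r)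
  have lo : ∀ x y : ℤ, x + 1 ≤ y → -4 ≤ expDiag (1 + r) x y + reflect (expDiag (1 + r)) x y := by
    intro x y hxy
    have h1 := neg_two_le_expDiag hl hxy
    have h2 := neg_two_le_expDiag hl (show (1 - y) + 1 ≤ 1 - x by omega)
    unfold reflect
    linarith
  have hi : ∀ x y : ℤ, expDiag (1 + r) x y + reflect (expDiag (1 + r)) x y ≤ 0 := by
    intro x y
    have h1 := expDiag_nonpos hl x y
    have h2 := expDiag_nonpos hl (1 - y) (1 - x)
    unfold reflect
    linarith
  -- With `r ^ 2 * T = 1` the bound is `(4 + 8) / (r / 4) = 48 * √T`. The `4` is the range of the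
  -- test function; `η` adds the two errors `4 * r ^ 2`.
  have main := hZ.lintegral_localTime_le (hm.add hm.reflect) (R := 4) (m := 0)
    (A := D \ {corner}) (κ := r / 4) (η := 8 * r ^ 2)
    (fun x y h => abs_le.2 ⟨lo x y h, (hi x y).trans (by norm_num)⟩) (fun x y _ => hi x y)
    (by positivity) ?_ hT
  · refine main.trans (ENNReal.ofReal_le_ofReal ?_)
    have h1 := lo _ _ z.2
    have hrT : r ^ 2 * T = 1 := by
      rw [hr, inv_pow, Real.sq_sqrt hT]
      field_simp
    have hrs : r * Real.sqrt T = 1 := by rw [hr]; field_simp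
    rw [div_le_iff₀ (by positivity)]
    linarith
  · intro u
    obtain ⟨⟨x, y⟩, hxy⟩ := u
    simp only [ge_iff_le] at hxy
    simp only
    rw [lap_add, lap_reflect]
    have g1 := le_lap_expDiag hl hl2 hxy
    have g2 := le_lap_expDiag hl hl2 (show (1 - y) + 1 ≤ 1 - x by omega)
    simp only [add_sub_cancel_left] at g1 g2
    by_cases h : (⟨(x, y), hxy⟩ : V) ∈ D \ {corner}
    · rw [Set.indicator_of_mem h, mul_one]
      have hy : y = x + 1 := h.1
      have hx : x ≠ 0 := by
        rintro rfl
        exact h.2 (by subst hy; rfl)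
      subst hy
      -- Each side of the corner is handled by one summand; the other costs at most `4 * r ^ 2`.
      rcases lt_or_gt_of_ne hx with hx | hx
      · have := lap_expDiag_diag hl hl2 (x := -x) (by omega)
        rw [show 1 - (x + 1) = -x by ring, show 1 - x = -x + 1 by ring]
        simp only [add_sub_cancel_left] at this
        linarith [sq_nonneg r]
      · have := lap_expDiag_diag hl hl2 (x := x) (by omega)
        simp only [add_sub_cancel_left] at this
        linarith [sq_nonneg r]
    · rw [Set.indicator_of_notMem h]
      linarith

end Walk
end SlowBond

end

/-! ### Conclusion with `T = t * n ^ 2` -/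

theorem proposition3p1 (α : ℝ) (hα : 0 < α) :
    ∃ c : ℝ, 0 < c ∧ ∀ (z : SlowBond.V) (n : ℕ), 1 ≤ n → ∀ t : ℝ, 0 ≤ t →
      ∀ (Ω : Type*) (mΩ : MeasurableSpace Ω) (P : Measure Ω) (_ : IsProbabilityMeasure P)
        (ℱ : Filtration ℝ≥0 mΩ) (Z : ℝ≥0 → Ω → SlowBond.V),
        SlowBond.IsWalk α n z P ℱ Z →
          (∫⁻ ω, SlowBond.localTime Z (t * (n : ℝ) ^ 2) (SlowBond.D \ {SlowBond.corner}) ω ∂P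
              ≤ ENNReal.ofReal (c * n * Real.sqrt t)) ∧
          (∫⁻ ω, SlowBond.localTime Z (t * (n : ℝ) ^ 2) {SlowBond.corner} ω ∂P
              ≤ ENNReal.ofReal (c * Real.log (1 + t * (n : ℝ) ^ 2))) ∧
          (2 ≤ t * (n : ℝ) ^ 2 →
            ∫⁻ ω, SlowBond.localTime Z (t * (n : ℝ) ^ 2) {SlowBond.corner} ω ∂P
              ≤ ENNReal.ofReal (c * Real.log (t * (n : ℝ) ^ 2))) := by
  obtain ⟨a, ha⟩ : ∃ a, a = 1 / (2 * Real.log (3 / 2)) := ⟨_, rfl⟩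
  have ha0 : 0 < a := by
    have : 0 < Real.log (3 / 2) := Real.log_pos (by norm_num)
    rw [ha]; positivity
  refine ⟨48 + 2 * a, by linarith, fun z n _ t ht Ω mΩ P _ ℱ Z hZ => ?_⟩
  have hT : 0 ≤ t * (n : ℝ) ^ 2 := by positivity
  have hc := hZ.lintegral_localTime_corner_le hT
  rw [← ha] at hc
  refine ⟨?_, ?_, fun h2 => ?_⟩
  · refine (hZ.lintegral_localTime_diag_le hT).trans (ENNReal.ofReal_le_ofReal ?_)
    rw [Real.sqrt_mul ht, Real.sqrt_sq (Nat.cast_nonneg n)]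
    have : 0 ≤ Real.sqrt t * n := by positivity
    nlinarith
  · refine hc.trans (ENNReal.ofReal_le_ofReal ?_)
    have : 0 ≤ Real.log (1 + t * (n : ℝ) ^ 2) := Real.log_nonneg (by linarith)
    nlinarith
  · refine hc.trans (ENNReal.ofReal_le_ofReal ?_)
    -- For `T ≥ 2`, `1 + T ≤ T ^ 2`; this is the source of the factor 2 in `2 * a`.
    have h3 : Real.log (1 + t * (n : ℝ) ^ 2) ≤ 2 * Real.log (t * (n : ℝ) ^ 2) := by
      rw [← Real.log_rpow (by linarith), Real.rpow_two]
      exact Real.log_le_log (by linarith) (by nlinarith)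
    have h4 : 0 ≤ Real.log (t * (n : ℝ) ^ 2) := Real.log_nonneg (by linarith)
    nlinarith
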